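/- A domain is a nonempty connected open set $G\subset\mathbb C^n$; $\mathcal O(G)$ denotes the space of holomorphic functions on $G$. The domain $G$ is called $n$-circled if $(e^{i\theta_1}z_1,\dots,e^{i\theta_n}z_n)\in G$ for all $(z_1,\dots,z_n)\in G$ and $(\theta_1,\dots,\theta_n)\in\mathbb R^n$, and fat if $G=\operatorname{int}\overline G$. For a family $\mathcal F\subset\mathcal O(G)$, $G$ is called an $\mathcal F$-domain of holomorphy if there are no domains $G_0,\widetilde G\subset\mathbb C^n$ with $\varnothing\ne G_0\subset G\cap\widetilde G$ and $\widetilde G\not\subset G$ such that for every $f\in\mathcal F$ there is $\widetilde f\in\mathcal O(\widetilde G)$ with $\widetilde f=f$ on $G_0$; a domain of holomorphy is an $\mathcal O(G)$-domain of holomorphy. For an integer $k\ge 0$ let $\mathcal A^k(G)$ be the set of all $f\in\mathcal O(G)$ such that for every multi-index $\nu\in(\mathbb Z_{\ge0})^n$ with $|\nu|\le k$ the derivative $\partial^\nu f=\frac{\partial^{|\nu|}f}{\partial z_1^{\nu_1}\cdots\partial z_n^{\nu_n}}$ extends continuously to $\overline G$. Let $G\subset\mathbb C^n$ be a bounded fat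 $n$-circled domain of holomorphy. Then, for every integer $k\ge0$, $G$ is an $\mathcal A^k(G)$-domain of holomorphy. -/

import Mathlib

namespace CircledDomains

/-- A domain in `ℂⁿ`: a nonempty connected open set. -/
def IsRegion {n : ℕ} (G : Set (Fin n → ℂ)) : Prop :=
  IsOpen G ∧ IsConnected G

/-- `𝒪(G)`: the functions holomorphic on the open set `G`. Functions are total; their values
outside `G` are irrelevant. -/
def holomorphicFunctions {n : ℕ} (G : Set (Fin n → ℂ)) : Set ((Fin n → ℂ) → ℂ) :=
  {f | DifferentiableOn ℂ f G}

/-- The complex partial derivative `∂f/∂z_j`. -/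
noncomputable def partialDeriv {n : ℕ} (j : Fin n) (f : (Fin n → ℂ) → ℂ) :
    (Fin n → ℂ) → ℂ :=
  fun z => lineDeriv ℂ f z (Pi.single j 1)

/-- The mixed partial derivative `∂^ν f = ∂₁^{ν₁} ⋯ ∂ₙ^{νₙ} f` for a multi-index `ν`. -/
noncomputable def multiPartialDeriv {n : ℕ} (ν : Fin n → ℕ) (f : (Fin n → ℂ) → ℂ) :
    (Fin n → ℂ) → ℂ :=
  (List.finRange n).foldr (fun j g => (partialDeriv j)^[ν j] g) f

/-- `𝒜^k(G)`: the functions holomorphic on `G` all of whose partial derivatives of order at most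
`k` extend continuously to the closure of `G`. -/
def spaceA {n : ℕ} (k : ℕ) (G : Set (Fin n → ℂ)) : Set ((Fin n → ℂ) → ℂ) :=
  {f | f ∈ holomorphicFunctions G ∧
    ∀ ν : Fin n → ℕ, ∑ j, ν j ≤ k →
      ∃ fν : (Fin n → ℂ) → ℂ, ContinuousOn fν (closure G) ∧ Set.EqOn fν (multiPartialDeriv ν f) G}

/-- `G` is an `ℱ`-domain of holomorphy, for a family `ℱ` of functions holomorphic on `G`: `G` is
a domain and there are no domains `G₀, G'` with `G₀ ⊆ G ∩ G'` and `G' ⊄ G` such that every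
`f ∈ ℱ` admits a function holomorphic on `G'` which equals `f` on `G₀`. -/
def IsDomainOfHolomorphyFor {n : ℕ} (F : Set ((Fin n → ℂ) → ℂ)) (G : Set (Fin n → ℂ)) : Prop :=
  IsRegion G ∧
    ¬ ∃ G₀ G' : Set (Fin n → ℂ), IsRegion G₀ ∧ IsRegion G' ∧ G₀ ⊆ G ∩ G' ∧ ¬ G' ⊆ G ∧
      ∀ f ∈ F, ∃ f' ∈ holomorphicFunctions G', Set.EqOn f' f G₀

/-- A domain of holomorphy is an `𝒪(G)`-domain of holomorphy. -/
def IsDomainOfHolomorphy {n : ℕ} (G : Set (Fin n → ℂ)) : Prop :=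
  IsDomainOfHolomorphyFor (holomorphicFunctions G) G

/-- `G` is `n`-circled: invariant under `(z₁, …, zₙ) ↦ (e^{iθ₁}z₁, …, e^{iθₙ}zₙ)`. -/
def IsCircled {n : ℕ} (G : Set (Fin n → ℂ)) : Prop :=
  ∀ z ∈ G, ∀ θ : Fin n → ℝ, (fun j => Complex.exp (Complex.I * (θ j : ℂ)) * z j) ∈ G

/-- `G` is fat: it is the interior of its closure. -/
def IsFat {n : ℕ} (G : Set (Fin n → ℂ)) : Prop :=
  G = interior (closure G)

end CircledDomains

/-! In the coordinates `x j = log ‖z j‖` a Laurent monomial has modulus `exp ⟨α, x⟩`, so separating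
a point from `G` by a monomial becomes separating it from the logarithmic image by a linear
functional.

The logarithmic image of a circled domain of holomorphy is convex, and stable under decreasing any
coordinate that vanishes somewhere on `G` (`logHull_subset_logImage`): the Laurent series of every
holomorphic function on `G` converges on the tube over the larger set, so that tube must lie in `G`.

Suppose all of `𝒜^k(G)` extended to some `G' ⊄ G`. By fatness `G'` contains a point `z₀` outside
`closure G`, with nonzero coordinates. Hahn-Banach separates its logarithm from the logarithmic
image; a large multiple of the functional, rounded up to integers and raised by `k + 1`, gives `α`
with `sup_G ‖z ^ α‖ < ‖z₀ ^ α‖` (`exists_decayingExponent_separating`). The extra `k + 1` makes `z ^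
α` smooth to order `k` up to the boundary, even where coordinates tend to zero. Then `1 / (z ^ α -
z₀ ^ α)` belongs to `𝒜^k(G)`, but the identity theorem forbids extending it across `z₀`. -/

namespace CircledDomains

open Filter Topology Metric Set

/-! ### Identity theorem, Cauchy estimates and normal convergence -/

section General

variable {E : Type*} [NormedAddCommGroup E] [NormedSpace ℂ E]

/-- Identity theorem for holomorphic functions of several variables. -/
theorem eqOn_zero_of_isPreconnected {U V : Set E} {f : E → ℂ} (hU : IsOpen U)
    (hUc : IsPreconnected U) (hf : DifferentiableOn ℂ f U) (hV : IsOpen V) (hVne : V.Nonempty)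
    (hVU : V ⊆ U) (h0 : ∀ z ∈ V, f z = 0) : ∀ z ∈ U, f z = 0 := by
  have key : U ⊆ interior {z | f z = 0} := by
    refine hUc.subset_of_closure_inter_subset isOpen_interior ?_ ?_
    · obtain ⟨v, hv⟩ := hVne
      exact ⟨v, hVU hv, mem_interior.2 ⟨V, h0, hV, hv⟩⟩
    rintro a ⟨ha, haU⟩
    obtain ⟨r, hr, hrU⟩ := Metric.isOpen_iff.1 hU a haU
    obtain ⟨b, hbr, hb⟩ := (_root_.mem_closure_iff.1 ha) (ball a r) isOpen_ball (mem_ball_self hr)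
    refine mem_interior.2 ⟨ball a r, fun c hc => ?_, isOpen_ball, mem_ball_self hr⟩
    -- On the complex line from `b`, near which `f` vanishes, to `c`, the one-variable identity
    -- theorem applies, because the part of the line inside the ball is convex.
    let l : ℂ → E := fun t => b + t • (c - b)
    have hl : Differentiable ℂ l := by fun_prop
    let S : Set ℂ := l ⁻¹' ball a r
    have hSo : IsOpen S := isOpen_ball.preimage hl.continuous
    have hSc : Convex ℝ S := by
      intro x hx y hy s t hs ht hst
      have : l (s • x + t • y) = s • l x + t • l y := by
        have hb : b = (s : ℂ) • b + (t : ℂ) • b := by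
          rw [← add_smul]; norm_cast; rw [hst]; simp
        simp only [l, Complex.real_smul]
        rw [← Complex.coe_smul s, ← Complex.coe_smul t]
        nth_rewrite 1 [hb]
        module
      let _ : NormedSpace ℝ E := NormedSpace.restrictScalars ℝ ℂ E
      change l _ ∈ ball a r
      rw [this]
      exact convex_ball a r hx hy hs ht hst
    have hd : DifferentiableOn ℂ (f ∘ l) S :=
      (hf.mono hrU).comp hl.differentiableOn fun x hx => hx
    have h0S : (0 : ℂ) ∈ S := by simpa [S, l] using hbr
    have hev : (f ∘ l) =ᶠ[𝓝 0] 0 := by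
      have : l ⁻¹' interior {z | f z = 0} ∈ 𝓝 (0 : ℂ) :=
        (isOpen_interior.preimage hl.continuous).mem_nhds (by simpa [l] using hb)
      filter_upwards [this] with t ht
      exact (interior_subset ht : l t ∈ {z | f z = 0})
    have := (hd.analyticOnNhd hSo).eqOn_zero_of_preconnected_of_eventuallyEq_zero
      hSc.isPreconnected h0S hev (x := 1) (by simpa [S, l] using hc)
    simpa [l] using this
  exact fun z hz => (interior_subset (key hz) : z ∈ {z | f z = 0})

theorem norm_fderiv_le_of_forall_norm_le {f : E → ℂ} {c : E} {r M : ℝ} (hr : 0 < r)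
    (hf : DifferentiableOn ℂ f (ball c r)) (hM : ∀ z ∈ ball c r, ‖f z‖ ≤ M) :
    ‖fderiv ℂ f c‖ ≤ 2 * M / r := by
  refine Complex.norm_fderiv_le_div_of_mapsTo_ball hf (fun z hz => ?_) hr
  rw [mem_closedBall, dist_eq_norm]
  calc _ ≤ ‖f z‖ + ‖f c‖ := norm_sub_le _ _
    _ ≤ 2 * M := by linarith [hM z hz, hM c (mem_ball_self hr)]

/-- Weierstrass' theorem: Cauchy estimates on balls of half the radius make the series of
derivatives normally convergent too. -/
theorem differentiableAt_tsum_of_norm_le {ι : Type*} {F : ι → E → ℂ} {u : ι → ℝ} {c : E} {r : ℝ}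
    (hr : 0 < r) (hu : Summable u) (hF : ∀ i, DifferentiableOn ℂ (F i) (ball c r))
    (hM : ∀ i, ∀ z ∈ ball c r, ‖F i z‖ ≤ u i) :
    DifferentiableAt ℂ (fun z => ∑' i, F i z) c := by
  let _ : NormedSpace ℝ E := NormedSpace.restrictScalars ℝ ℂ E
  have hsub : ∀ x ∈ ball c (r / 2), ball x (r / 2) ⊆ ball c r := fun x hx =>
    ball_subset_ball' (by linarith [mem_ball.1 hx])
  have hc : c ∈ ball c (r / 2) := mem_ball_self (by positivity)
  refine (hasFDerivAt_tsum_of_isPreconnected (f' := fun i x => fderiv ℂ (F i) x) (x₀ := c)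
    (u := fun i => 2 * u i / (r / 2)) ((hu.mul_left 2).div_const _) isOpen_ball
    (convex_ball c (r / 2)).isPreconnected (fun i x hx => ?_) (fun i x hx => ?_) hc ?_
    hc).differentiableAt
  · exact ((hF i).differentiableAt (isOpen_ball.mem_nhds
      (hsub x hx (mem_ball_self (by positivity))))).hasFDerivAt
  · exact norm_fderiv_le_of_forall_norm_le (by positivity) ((hF i).mono (hsub x hx))
      fun z hz => hM i z (hsub x hx hz)
  · exact Summable.of_norm_bounded hu fun i => hM i c (mem_ball_self hr)

end General

/-! ### Laurent expansion by Fourier analysis on torus orbits -/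

noncomputable section Torus

open MeasureTheory UnitAddTorus

/-- The normalized Haar measure on the circle, as in `Mathlib.Analysis.Fourier.AddCircleMulti`. -/
local instance : MeasureSpace UnitAddCircle := ⟨AddCircle.haarAddCircle⟩

local instance : Measure.IsAddHaarMeasure (volume : Measure UnitAddCircle) :=
  inferInstanceAs (Measure.IsAddHaarMeasure AddCircle.haarAddCircle)

local instance : IsProbabilityMeasure (volume : Measure UnitAddCircle) :=
  inferInstanceAs (IsProbabilityMeasure AddCircle.haarAddCircle)

variable {n : ℕ}

/-- The Laurent monomial `z ^ α`. -/
def zmonomial (α : Fin n → ℤ) (z : Fin n → ℂ) : ℂ := ∏ j, z j ^ α j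

/-- The action of the torus on `ℂⁿ` by rotations. -/
def rotate (t : UnitAddTorus (Fin n)) (z : Fin n → ℂ) : Fin n → ℂ :=
  fun j => fourier 1 (t j) * z j

theorem IsCircled.rotate_mem {G : Set (Fin n → ℂ)} (hG : IsCircled G) {z : Fin n → ℂ}
    (hz : z ∈ G) (t : UnitAddTorus (Fin n)) : rotate t z ∈ G := by
  choose x hx using fun j => QuotientAddGroup.mk_surjective (t j)
  have := hG z hz fun j => 2 * Real.pi * x j
  convert this using 1
  ext j
  have hxj : t j = ((x j : ℝ) : UnitAddCircle) := (hx j).symm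
  simp only [rotate, hxj, fourier_coe_apply]
  congr 2
  push_cast
  simp
  ring

theorem rotate_zero (z : Fin n → ℂ) : rotate 0 z = z := by
  ext j; simp [rotate]

theorem rotate_add (s t : UnitAddTorus (Fin n)) (z : Fin n → ℂ) :
    rotate s (rotate t z) = rotate (t + s) z := by
  ext j; simp only [rotate, Pi.add_apply, fourier_one, AddCircle.toCircle_add, Circle.coe_mul]; ring

theorem continuous_rotate_left (z : Fin n → ℂ) :
    Continuous fun t : UnitAddTorus (Fin n) => rotate t z := by
  unfold rotate; fun_prop

theorem norm_rotate_sub (t : UnitAddTorus (Fin n)) (z w : Fin n → ℂ) :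
    ‖rotate t z - rotate t w‖ = ‖z - w‖ := by
  have (j : Fin n) : ‖(rotate t z - rotate t w) j‖ = ‖(z - w) j‖ := by
    simp only [rotate, Pi.sub_apply, ← mul_sub, norm_mul, fourier_one, Circle.norm_coe, one_mul]
  rw [Pi.norm_def, Pi.norm_def]
  exact congrArg _ (Finset.sup_congr rfl fun j _ => NNReal.eq (this j))

/-- The part of `f` which is homogeneous of multidegree `α` under rotations. -/
def laurentPart (f : (Fin n → ℂ) → ℂ) (α : Fin n → ℤ) (w : Fin n → ℂ) : ℂ :=
  mFourierCoeff (fun t => f (rotate t w)) α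

/-- Translation invariance of Haar measure, together with the character property of `mFourier`. -/
theorem laurentPart_rotate (f : (Fin n → ℂ) → ℂ) (α : Fin n → ℤ) (s : UnitAddTorus (Fin n))
    (w : Fin n → ℂ) : laurentPart f α (rotate s w) = mFourier α s * laurentPart f α w := by
  simp only [laurentPart, mFourierCoeff, rotate_add]
  rw [← integral_const_mul,
    ← integral_add_left_eq_self (fun t => mFourier α s * (mFourier (-α) t • f (rotate t w))) s]
  congr 1
  ext t
  have h1 : mFourier (-α) (s + t) = mFourier (-α) s * mFourier (-α) t := by
    simp only [mFourier, ContinuousMap.coe_mk, Pi.add_apply, fourier_apply, smul_add,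
      AddCircle.toCircle_add, Circle.coe_mul, Finset.prod_mul_distrib]
  have h2 : mFourier α s * mFourier (-α) s = 1 := by
    rw [← mFourier_add, add_neg_cancel, mFourier_zero, ContinuousMap.one_apply]
  rw [h1, smul_eq_mul, smul_eq_mul, ← mul_assoc, ← mul_assoc, h2, one_mul]

theorem norm_laurentPart_le {f : (Fin n → ℂ) → ℂ} {M : ℝ} {w : Fin n → ℂ}
    (hM : ∀ t, ‖f (rotate t w)‖ ≤ M) (α : Fin n → ℤ) : ‖laurentPart f α w‖ ≤ M := by
  have := norm_integral_le_of_norm_le_const (μ := (volume : Measure (UnitAddTorus (Fin n))))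
    (f := fun t => mFourier (-α) t • f (rotate t w)) (C := M) (Eventually.of_forall fun t => by
      rw [norm_smul]
      calc _ ≤ 1 * ‖f (rotate t w)‖ := by
            gcongr
            exact (ContinuousMap.norm_coe_le_norm _ t).trans mFourier_norm.le
        _ ≤ M := by rw [one_mul]; exact hM t)
  simpa [laurentPart, mFourierCoeff] using this

theorem exists_norm_rotate_le {G : Set (Fin n → ℂ)} (hG : IsCircled G)
    {f : (Fin n → ℂ) → ℂ} (hf : ContinuousOn f G) {w : Fin n → ℂ} (hw : w ∈ G) :
    ∃ M, ∀ t, ‖f (rotate t w)‖ ≤ M := by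
  have hc : Continuous fun t : UnitAddTorus (Fin n) => f (rotate t w) :=
    hf.comp_continuous (continuous_rotate_left _) fun t => hG.rotate_mem hw t
  obtain ⟨M, hM⟩ := isCompact_univ.exists_bound_of_continuousOn hc.continuousOn
  exact ⟨M, fun t => hM t trivial⟩

/-- The Laurent parts at `w` are the Fourier coefficients of `f` along the orbit of `w`; the Fourier
series is evaluated at the identity of the torus. -/
theorem hasSum_laurentPart {G : Set (Fin n → ℂ)} (hG : IsCircled G)
    {f : (Fin n → ℂ) → ℂ} (hf : ContinuousOn f G) {w : Fin n → ℂ} (hw : w ∈ G)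
    (hs : Summable fun α => laurentPart f α w) : HasSum (fun α => laurentPart f α w) (f w) := by
  have hc : Continuous fun t : UnitAddTorus (Fin n) => f (rotate t w) :=
    hf.comp_continuous (continuous_rotate_left _) fun t => hG.rotate_mem hw t
  have := hasSum_mFourier_series_apply_of_summable (f := ⟨_, hc⟩) hs 0
  have h1 (α : Fin n → ℤ) : mFourier α (0 : UnitAddTorus (Fin n)) = 1 := by
    simp [mFourier]
  simpa [h1, rotate_zero, laurentPart] using this

theorem differentiableOn_laurentPart {G : Set (Fin n → ℂ)} (hGo : IsOpen G) (hG : IsCircled G)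
    {f : (Fin n → ℂ) → ℂ} (hf : DifferentiableOn ℂ f G) (α : Fin n → ℤ) :
    DifferentiableOn ℂ (laurentPart f α) G := by
  intro w hw
  let D : UnitAddTorus (Fin n) → (Fin n → ℂ) →L[ℂ] (Fin n → ℂ) := fun t =>
    ContinuousLinearMap.pi fun j => (fourier 1 (t j) : ℂ) • ContinuousLinearMap.proj j
  have hD (t z) : D t z = rotate t z := by ext j; simp [D, rotate]
  have hDc : Continuous D := by
    have : D = fun t => ∑ j, (fourier 1 (t j) : ℂ) •
        ((ContinuousLinearMap.single ℂ (fun _ => ℂ) j).comp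
          (ContinuousLinearMap.proj j : (Fin n → ℂ) →L[ℂ] ℂ)) := by
      ext t z j
      simp [D, Pi.single_apply]
    rw [this]
    fun_prop
  have hDn (t) : ‖D t‖ ≤ 1 := by
    refine ContinuousLinearMap.opNorm_le_bound _ zero_le_one fun z => ?_
    rw [hD, one_mul]
    have := norm_rotate_sub t z 0
    simpa [show rotate t 0 = 0 by ext j; simp [rotate]] using this.le
  -- The orbit is compact, so a whole thickening of it lies in `G` and `f` is bounded there. Cauchy
  -- estimates then bound the derivative of the integrand uniformly in `t`, which permits
  -- differentiation under the integral.
  let K : Set (Fin n → ℂ) := range fun t : UnitAddTorus (Fin n) => rotate t w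
  have hK : IsCompact K := isCompact_range (continuous_rotate_left _)
  have hKG : K ⊆ G := by rintro _ ⟨t, rfl⟩; exact hG.rotate_mem hw t
  obtain ⟨δ, hδ, hδG⟩ := hK.exists_cthickening_subset_open hGo hKG
  obtain ⟨M, hM⟩ := (hK.cthickening (r := δ)).exists_bound_of_continuousOn (hf.continuousOn.mono hδG)
  have hthick : ∀ t, ∀ x ∈ ball w (δ / 2), ball (rotate t x) (δ / 2) ⊆ cthickening δ K := by
    intro t x hx
    refine (ball_subset_ball' (y := rotate t w) (ε₂ := δ) ?_).trans
      ((ball_subset_thickening (show rotate t w ∈ K from ⟨t, rfl⟩) δ).trans (thickening_subset_cthickening _ _))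
    rw [dist_eq_norm, norm_rotate_sub, ← dist_eq_norm]
    linarith [mem_ball.1 hx]
  have hmem : ∀ t, ∀ x ∈ ball w (δ / 2), rotate t x ∈ G := fun t x hx =>
    hδG (hthick t x hx (mem_ball_self (by positivity)))
  have hcont : ∀ x ∈ ball w (δ / 2), Continuous fun t : UnitAddTorus (Fin n) => f (rotate t x) :=
    fun x hx => hf.continuousOn.comp_continuous (continuous_rotate_left _)
      fun t => hmem t x hx
  have hw' : w ∈ ball w (δ / 2) := mem_ball_self (by positivity)
  refine DifferentiableAt.differentiableWithinAt (HasFDerivAt.differentiableAt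
    (hasFDerivAt_integral_of_dominated_of_fderiv_le
      (F := fun x t => mFourier (-α) t • f (rotate t x))
      (F' := fun x t => mFourier (-α) t • (fderiv ℂ f (rotate t x)).comp (D t))
      (bound := fun _ => 2 * M / (δ / 2)) (s := ball w (δ / 2))
      (isOpen_ball.mem_nhds hw') ?_ ?_ ?_ ?_ ?_ ?_))
  · filter_upwards [isOpen_ball.mem_nhds hw'] with x hx
    exact ((mFourier (-α)).continuous.smul (hcont x hx)).aestronglyMeasurable
  · exact ((mFourier (-α)).continuous.smul (hcont w hw')).integrable_of_hasCompactSupport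
      (HasCompactSupport.of_compactSpace _)
  · refine (mFourier (-α)).continuous.aestronglyMeasurable.smul ?_
    have h1 : AEStronglyMeasurable (fun t : UnitAddTorus (Fin n) => fderiv ℂ f (rotate t w))
        volume := by
      have : Continuous fun t : UnitAddTorus (Fin n) => rotate t w :=
        continuous_rotate_left _
      exact ((measurable_fderiv ℂ f).comp this.measurable).aestronglyMeasurable
    have h2 : Continuous fun p : ((Fin n → ℂ) →L[ℂ] ℂ) × ((Fin n → ℂ) →L[ℂ] (Fin n → ℂ)) =>
        p.1.comp p.2 := by fun_prop
    exact h2.comp_aestronglyMeasurable (h1.prodMk hDc.aestronglyMeasurable)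
  · refine Eventually.of_forall fun t x hx => ?_
    have hb := norm_fderiv_le_of_forall_norm_le (f := f) (c := rotate t x) (r := δ / 2) (M := M)
      (by positivity) (hf.mono ((hthick t x hx).trans hδG)) fun z hz => hM z (hthick t x hx hz)
    rw [norm_smul]
    calc _ ≤ 1 * (2 * M / (δ / 2) * 1) := by
          gcongr
          · exact (ContinuousMap.norm_coe_le_norm _ t).trans mFourier_norm.le
          · exact (ContinuousLinearMap.opNorm_comp_le _ _).trans
              (mul_le_mul hb (hDn t) (norm_nonneg _) ((norm_nonneg _).trans hb))
      _ = _ := by ring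
  · exact integrable_const _
  · refine Eventually.of_forall fun t x hx => ?_
    refine HasFDerivAt.fun_const_smul ?_ _
    have h1 := (hf.differentiableAt (hGo.mem_nhds (hmem t x hx))).hasFDerivAt
    have h2 : HasFDerivAt (fun z => rotate t z) (D t) x := by
      have := (D t).hasFDerivAt (x := x)
      exact this.congr_of_eventuallyEq (Eventually.of_forall fun z => (hD t z).symm)
    exact h1.comp x h2

theorem differentiableAt_zmonomial {α : Fin n → ℤ} {z : Fin n → ℂ}
    (h : ∀ j, z j ≠ 0 ∨ 0 ≤ α j) : DifferentiableAt ℂ (zmonomial α) z := by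
  unfold zmonomial
  have h1 (j : Fin n) : DifferentiableAt ℂ (fun z : Fin n → ℂ => z j ^ α j) z := by
    have : DifferentiableAt ℂ (fun z : Fin n → ℂ => z j) z := by fun_prop
    exact this.zpow (h j)
  exact (HasFDerivAt.finsetProd fun j _ => (h1 j).hasFDerivAt).differentiableAt

theorem zmonomial_add {α β : Fin n → ℤ} {z : Fin n → ℂ} (h : ∀ j, z j ≠ 0) :
    zmonomial (α + β) z = zmonomial α z * zmonomial β z := by
  simp only [zmonomial, ← Finset.prod_mul_distrib, Pi.add_apply, zpow_add₀ (h _)]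

theorem zmonomial_ne_zero {α : Fin n → ℤ} {z : Fin n → ℂ} (h : ∀ j, z j ≠ 0) :
    zmonomial α z ≠ 0 :=
  Finset.prod_ne_zero_iff.2 fun j _ => zpow_ne_zero _ (h j)

theorem mul_zmonomial_negPart {α : Fin n → ℤ} {z : Fin n → ℂ} (h : ∀ j, z j ≠ 0) :
    zmonomial α z * zmonomial α⁻ z = zmonomial α⁺ z := by
  rw [← zmonomial_add h]
  congr 1
  rw [← eq_sub_iff_add_eq, posPart_sub_negPart]

theorem exists_mem_forall_ne_zero {G : Set (Fin n → ℂ)} (hGo : IsOpen G) (hne : G.Nonempty) :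
    ∃ p ∈ G, ∀ j, p j ≠ 0 := by
  have hd : Dense (Set.univ.pi fun _ : Fin n => ({0}ᶜ : Set ℂ)) :=
    dense_pi _ fun j _ => dense_compl_singleton 0
  obtain ⟨p, hp, hpG⟩ := hd.inter_open_nonempty G hGo hne
  exact ⟨p, hp, fun j => hpG j trivial⟩

/-- The Laurent coefficients of a holomorphic function on a circled domain. -/
theorem exists_laurentCoeff {G : Set (Fin n → ℂ)} (hGr : IsRegion G) (hG : IsCircled G)
    {f : (Fin n → ℂ) → ℂ} (hf : DifferentiableOn ℂ f G) (α : Fin n → ℤ) :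
    ∃ a : ℂ, ∀ w ∈ G, laurentPart f α w * zmonomial α⁻ w = a * zmonomial α⁺ w := by
  obtain ⟨hGo, hGc⟩ := hGr
  have hA := differentiableOn_laurentPart hGo hG hf α
  obtain ⟨p, hpG, hp⟩ := exists_mem_forall_ne_zero hGo hGc.nonempty
  let ex : (Fin n → ℂ) → (Fin n → ℂ) := fun ζ j => Complex.exp (ζ j)
  have hex : Differentiable ℂ ex := by fun_prop
  let ζ₀ : Fin n → ℂ := fun j => Complex.log (p j)
  have hζ₀ : ex ζ₀ = p := by ext j; exact Complex.exp_log (hp j)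
  obtain ⟨r, hr, hrG⟩ := Metric.isOpen_iff.1 (hGo.preimage hex.continuous) ζ₀
    (by rwa [mem_preimage, hζ₀])
  -- In logarithmic coordinates, `F` is the quotient of the Laurent part by `z ^ α`. Rotations
  -- become imaginary translations, which leave `F` invariant; by complex linearity its derivative
  -- vanishes and `F` is locally constant.
  let F : (Fin n → ℂ) → ℂ := fun ζ => laurentPart f α (ex ζ) * Complex.exp (-∑ j, α j * ζ j)
  have hF : DifferentiableOn ℂ F (ball ζ₀ r) := by
    refine (hA.comp hex.differentiableOn hrG).mul ?_
    fun_prop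
  have hinv : ∀ ζ, ∀ j, ∀ s : ℝ, F (ζ + (s : ℂ) • Pi.single j Complex.I) = F ζ := by
    intro ζ j s
    let t : UnitAddTorus (Fin n) := Pi.single j ((s / (2 * Real.pi) : ℝ) : UnitAddCircle)
    have hpi : (Real.pi : ℂ) ≠ 0 := by exact_mod_cast Real.pi_ne_zero
    have h1 : ex (ζ + (s : ℂ) • Pi.single j Complex.I) = rotate t (ex ζ) := by
      ext i
      rcases eq_or_ne i j with rfl | hij
      · simp only [ex, Pi.add_apply, Pi.smul_apply, Pi.single_eq_same, rotate, t, smul_eq_mul,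
          fourier_coe_apply, Complex.exp_add]
        rw [mul_comm]
        congr 2
        push_cast
        field_simp
      · simp [ex, rotate, t, hij]
    have h2 : mFourier α t = Complex.exp (α j * s * Complex.I) := by
      change ∏ i, fourier (α i) (t i) = _
      rw [Finset.prod_eq_single j (fun i _ hij => by simp [t, hij]) (by simp)]
      simp only [t, Pi.single_eq_same, fourier_coe_apply]
      congr 1
      push_cast
      field_simp
    have h3 : ∑ i, α i * (ζ + (s : ℂ) • Pi.single j Complex.I : Fin n → ℂ) i =
        ∑ i, α i * ζ i + α j * s * Complex.I := by
      simp [mul_add, Finset.sum_add_distrib, Pi.single_apply, mul_assoc]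
    simp only [F]
    rw [h1, laurentPart_rotate, h2, h3, neg_add, Complex.exp_add, Complex.exp_neg (α j * s * _)]
    field_simp [Complex.exp_ne_zero]
  have hF0 : ∀ ζ ∈ ball ζ₀ r, fderiv ℂ F ζ = 0 := by
    intro ζ hζ
    have hd := (hF.differentiableAt (isOpen_ball.mem_nhds hζ)).hasFDerivAt
    have hz (j : Fin n) : fderiv ℂ F ζ (Pi.single j Complex.I) = 0 := by
      have hl : HasDerivAt (fun s : ℂ => ζ + s • (Pi.single j Complex.I : Fin n → ℂ))
          (Pi.single j Complex.I) ((0 : ℝ) : ℂ) := by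
        simpa using ((hasDerivAt_id ((0 : ℝ) : ℂ)).smul_const
          (Pi.single j Complex.I : Fin n → ℂ)).const_add ζ
      have h1 := (HasFDerivAt.comp_hasDerivAt_of_eq _ hd hl (by simp)).comp_ofReal
      have h2 := h1.congr_of_eventuallyEq (f₁ := fun _ : ℝ => F ζ)
        (Eventually.of_forall fun s => (hinv ζ j s).symm)
      exact h2.unique (hasDerivAt_const _ _)
    have hb (j : Fin n) : (Pi.single j 1 : Fin n → ℂ) = (-Complex.I) • Pi.single j Complex.I := by
      rw [← Pi.single_smul]; simp
    ext v
    have hv : v = ∑ j, v j • (Pi.single j 1 : Fin n → ℂ) := by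
      ext i; simp [Pi.single_apply]
    rw [hv]
    simp only [map_sum, map_smul, hb, hz]
    simp
  have hconst : ∀ ζ ∈ ball ζ₀ r, F ζ = F ζ₀ := fun ζ hζ =>
    isOpen_ball.is_const_of_fderiv_eq_zero (convex_ball ζ₀ r).isPreconnected hF
      (fun x hx => hF0 x hx) hζ (mem_ball_self hr)
  refine ⟨F ζ₀, ?_⟩
  -- A branch of the logarithm near `p`: the quotient `w j / p j` is close to `1`, away from the
  -- cut.
  let lg : (Fin n → ℂ) → (Fin n → ℂ) := fun w j => ζ₀ j + Complex.log (w j / p j)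
  have hlgp : lg p = ζ₀ := by ext j; simp [lg, hp j]
  have hlgc : ContinuousAt lg p := by
    refine continuousAt_pi.2 fun j => ContinuousAt.add continuousAt_const ?_
    refine ContinuousAt.clog ?_ (by simp [hp j])
    exact (continuous_apply j).continuousAt.div_const _
  have hev : ∀ᶠ w in 𝓝 p, w ∈ G ∧ lg w ∈ ball ζ₀ r ∧ ∀ j, w j ≠ 0 := by
    refine Filter.Eventually.and (hGo.mem_nhds hpG) (((hlgp ▸ hlgc.tendsto).eventually (p := fun x => x ∈ ball ζ₀ r) ?_).and
      (eventually_all.2 fun j => (continuous_apply j).continuousAt.eventually_ne (hp j)))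
    exact isOpen_ball.mem_nhds (mem_ball_self hr)
  obtain ⟨ρ, hρ, hρV⟩ := Metric.eventually_nhds_iff_ball.1 hev
  have hzero := eqOn_zero_of_isPreconnected (V := ball p ρ)
    (f := fun w => laurentPart f α w * zmonomial α⁻ w - F ζ₀ * zmonomial α⁺ w) hGo
    hGc.isPreconnected ?_ isOpen_ball ⟨p, mem_ball_self hρ⟩ (fun w hw => (hρV w hw).1) ?_
  · exact fun w hw => sub_eq_zero.1 (hzero w hw)
  · have h1 (w : Fin n → ℂ) : DifferentiableAt ℂ (zmonomial α⁻) w :=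
      differentiableAt_zmonomial fun j => Or.inr (negPart_nonneg α j)
    have h2 (w : Fin n → ℂ) : DifferentiableAt ℂ (zmonomial α⁺) w :=
      differentiableAt_zmonomial fun j => Or.inr (posPart_nonneg α j)
    exact (hA.mul fun w _ => (h1 w).differentiableWithinAt).sub
      fun w _ => ((h2 w).const_mul _).differentiableWithinAt
  · intro w hw
    obtain ⟨-, hwb, hw0⟩ := hρV w hw
    have hexw : ex (lg w) = w := by
      ext j
      simp only [ex, lg, ζ₀, Complex.exp_add]
      rw [Complex.exp_log (hp j), Complex.exp_log (div_ne_zero (hw0 j) (hp j)),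
        mul_div_cancel₀ _ (hp j)]
    have hzm : Complex.exp (∑ j, α j * lg w j) = zmonomial α w := by
      rw [Complex.exp_sum, zmonomial]
      refine Finset.prod_congr rfl fun j _ => ?_
      rw [Complex.exp_int_mul, ← congrFun hexw j]
    have hlw : F (lg w) = laurentPart f α w / zmonomial α w := by
      simp only [F, hexw, Complex.exp_neg, hzm, div_eq_mul_inv]
    have := hconst _ hwb
    rw [hlw, div_eq_iff (zmonomial_ne_zero hw0)] at this
    rw [this, mul_assoc, mul_zmonomial_negPart hw0, sub_self]

end Torus

/-! ### Logarithmic convexity of circled domains of holomorphy -/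

section LogImage

open scoped Pointwise

variable {n : ℕ}

/-- The logarithmic image of a circled set. -/
def logImage (G : Set (Fin n → ℂ)) : Set (Fin n → ℝ) :=
  {x | (fun j => (Real.exp (x j) : ℂ)) ∈ G}

/-- The coordinates which vanish somewhere on `G`. -/
def vanishingCoords (G : Set (Fin n → ℂ)) : Set (Fin n) := {j | ∃ z ∈ G, z j = 0}

/-- The convex hull of the logarithmic image, completed in the directions of the coordinates which
vanish somewhere on `G`. -/
def logHull (G : Set (Fin n → ℂ)) : Set (Fin n → ℝ) :=
  convexHull ℝ (logImage G) + {s : Fin n → ℝ | ∀ j, s j ≤ 0 ∧ (j ∉ vanishingCoords G → s j = 0)}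

theorem IsCircled.log_mem_logImage_iff {G : Set (Fin n → ℂ)} (hG : IsCircled G) {z : Fin n → ℂ}
    (hz : ∀ j, z j ≠ 0) : (fun j => Real.log ‖z j‖) ∈ logImage G ↔ z ∈ G := by
  have h1 (j : Fin n) : (Real.exp (Real.log ‖z j‖) : ℂ) = ‖z j‖ := by
    rw [Real.exp_log (norm_pos_iff.2 (hz j))]
  simp only [logImage, mem_ofPred_eq, h1]
  constructor
  · intro h
    convert hG _ h fun j => (z j).arg using 1
    ext j
    rw [mul_comm, mul_comm Complex.I, Complex.norm_mul_exp_arg_mul_I]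
  · intro h
    convert hG _ h fun j => -(z j).arg using 1
    ext j
    calc (‖z j‖ : ℂ) = Complex.exp (Complex.I * ((-(z j).arg : ℝ) : ℂ)) *
          (‖z j‖ * Complex.exp ((z j).arg * Complex.I)) := by
          rw [mul_left_comm, ← Complex.exp_add]; simp [mul_comm]
      _ = _ := by rw [Complex.norm_mul_exp_arg_mul_I]

theorem isOpen_logImage {G : Set (Fin n → ℂ)} (hG : IsOpen G) : IsOpen (logImage G) :=
  hG.preimage (by fun_prop)

theorem logImage_subset_logHull (G : Set (Fin n → ℂ)) : logImage G ⊆ logHull G := fun x hx =>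
  ⟨x, subset_convexHull _ _ hx, 0, by simp, by simp⟩

theorem isOpen_logHull {G : Set (Fin n → ℂ)} (hG : IsOpen G) : IsOpen (logHull G) :=
  (isOpen_logImage hG).convexHull.add_right

theorem convex_logHull (G : Set (Fin n → ℂ)) : Convex ℝ (logHull G) := by
  refine (convex_convexHull ℝ _).add fun x hx y hy s t hs ht _ j => ⟨?_, fun hj => ?_⟩
  · have h1 := mul_nonpos_of_nonneg_of_nonpos hs (hx j).1
    have h2 := mul_nonpos_of_nonneg_of_nonpos ht (hy j).1
    simpa using add_nonpos h1 h2
  · simp [(hx j).2 hj, (hy j).2 hj]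

theorem norm_zmonomial {α : Fin n → ℤ} {z : Fin n → ℂ} (hz : ∀ j, z j ≠ 0) :
    ‖zmonomial α z‖ = Real.exp (∑ j, α j * Real.log ‖z j‖) := by
  rw [zmonomial, norm_prod, Real.exp_sum]
  refine Finset.prod_congr rfl fun j _ => ?_
  rw [norm_zpow, mul_comm, Real.exp_mul, Real.exp_log (norm_pos_iff.2 (hz j)), Real.rpow_intCast]

theorem summable_prod_of_nonneg {g : ℤ → ℝ} (hg0 : ∀ k, 0 ≤ g k) (hg : Summable g) :
    ∀ n : ℕ, Summable fun α : Fin n → ℤ => ∏ j, g (α j)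
  | 0 => Summable.of_finite
  | n + 1 => by
    rw [← (Fin.consEquiv fun _ => ℤ).summable_iff]
    have := hg.mul_of_nonneg (summable_prod_of_nonneg hg0 hg n) (fun k => hg0 k)
      fun α => Finset.prod_nonneg fun j _ => hg0 _
    refine this.congr fun p => ?_
    simp [Fin.consEquiv, Fin.prod_univ_succ]

theorem summable_exp_neg_sum_abs {δ : ℝ} (hδ : 0 < δ) (n : ℕ) :
    Summable fun α : Fin n → ℤ => Real.exp (-(δ * ∑ j, |(α j : ℝ)|)) := by
  have hg : Summable fun k : ℤ => Real.exp (-(δ * |(k : ℝ)|)) := by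
    have h1 : Summable fun k : ℕ => Real.exp (-(δ * k)) := by
      have := Real.summable_exp_nat_mul_iff.2 (neg_lt_zero.2 hδ)
      refine this.congr fun k => ?_
      ring_nf
    refine Summable.of_nat_of_neg ?_ ?_
    · simpa using h1
    · simpa using h1
  refine (summable_prod_of_nonneg (fun k => (Real.exp_pos _).le) hg n).congr fun α => ?_
  rw [← Real.exp_sum, Finset.mul_sum, Finset.sum_neg_distrib]

/-- Boundedness of the terms of a Laurent series, as a condition on the logarithms of the
coordinates. -/
def boundedTerms (a : (Fin n → ℤ) → ℂ) : Set (Fin n → ℝ) :=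
  {x | ∃ M, ∀ α, ‖a α‖ * Real.exp (∑ j, α j * x j) ≤ M}

/-- The exponent of each term is linear in `x`, so at a convex combination it is at most the larger
of its values at the two endpoints. -/
theorem convex_boundedTerms (a : (Fin n → ℤ) → ℂ) : Convex ℝ (boundedTerms a) := by
  rintro x ⟨M, hM⟩ y ⟨N, hN⟩ s t hs ht hst
  refine ⟨max M N, fun α => ?_⟩
  set u := ∑ j, α j * x j
  set v := ∑ j, α j * y j
  have h1 : ∑ j, α j * (s • x + t • y) j = s * u + t * v := by
    simp only [u, v, Pi.add_apply, Pi.smul_apply, smul_eq_mul, mul_add, Finset.sum_add_distrib,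
      Finset.mul_sum]
    congr 1 <;> exact Finset.sum_congr rfl fun j _ => by ring
  rw [h1]
  have h2 : s * u + t * v ≤ max u v := by
    calc s * u + t * v ≤ s * max u v + t * max u v := by gcongr <;> simp
      _ = max u v := by rw [← add_mul, hst, one_mul]
  rcases le_max_iff.1 h2 with h | h
  · exact (mul_le_mul_of_nonneg_left (Real.exp_le_exp.2 h) (norm_nonneg _)).trans
      ((hM α).trans (le_max_left _ _))
  · exact (mul_le_mul_of_nonneg_left (Real.exp_le_exp.2 h) (norm_nonneg _)).trans
      ((hN α).trans (le_max_right _ _))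

/-- The Abel lemma for Laurent series: bounded terms on an open set imply locally normal
convergence. -/
theorem exists_summable_bound {a : (Fin n → ℤ) → ℂ} {U : Set (Fin n → ℝ)} (hU : IsOpen U)
    (hUa : U ⊆ boundedTerms a) {x : Fin n → ℝ} (hx : x ∈ U) :
    ∃ u : (Fin n → ℤ) → ℝ, Summable u ∧ ∃ δ > 0, ∀ y ∈ ball x δ, ∀ α,
      ‖a α‖ * Real.exp (∑ j, α j * y j) ≤ u α := by
  obtain ⟨r, hr, hrU⟩ := Metric.isOpen_iff.1 hU x hx
  set δ := r / 3
  have hδ : 0 < δ := by positivity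
  -- The term of index `α` is compared with its value at the point displaced from `x` by `2δ` in the
  -- direction of the signs of `α`. Points within `δ` of `x` still gain the factor `exp (-δ ∑ |α
  -- j|)`, and finitely many displaced points serve all `α`.
  let v : (Fin n → SignType) → Fin n → ℝ := fun ε j => x j + 2 * δ * (ε j : ℝ)
  have hv : ∀ ε, v ε ∈ U := fun ε => hrU <| by
    rw [mem_ball, dist_pi_lt_iff hr]
    intro j
    have : |(ε j : ℝ)| ≤ 1 := by
      rcases ε j with _ | _ | _ <;> simp
    simp only [v, Real.dist_eq, add_sub_cancel_left, abs_mul, abs_of_pos hδ]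
    norm_num
    calc 2 * δ * |(ε j : ℝ)| ≤ 2 * δ * 1 := by gcongr
      _ < r := by simp only [δ]; linarith
  choose M hM using fun ε => hUa (hv ε)
  let B := ∑ ε, |M ε|
  refine ⟨fun α => B * Real.exp (-(δ * ∑ j, |(α j : ℝ)|)),
    (summable_exp_neg_sum_abs hδ n).mul_left B, δ, hδ, fun y hy α => ?_⟩
  let ε : Fin n → SignType := fun j => SignType.sign (α j : ℝ)
  have h1 : ∑ j, α j * y j ≤ ∑ j, α j * v ε j + -(δ * ∑ j, |(α j : ℝ)|) := by
    rw [Finset.mul_sum, ← Finset.sum_neg_distrib, ← Finset.sum_add_distrib]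
    refine Finset.sum_le_sum fun j _ => ?_
    have h2 : |y j - x j| ≤ δ := by
      rw [← Real.dist_eq]; exact ((dist_le_pi_dist y x j).trans (mem_ball.1 hy).le)
    have h3 : (α j : ℝ) * (ε j : ℝ) = |(α j : ℝ)| := by
      simp only [ε]; rw [mul_comm]; exact sign_mul_self _
    have h4 : (α j : ℝ) * (y j - x j) ≤ |(α j : ℝ)| * δ :=
      (le_abs_self _).trans (by rw [abs_mul]; gcongr)
    simp only [v]
    linear_combination h4 - 2 * δ * h3
  calc ‖a α‖ * Real.exp (∑ j, α j * y j)
      ≤ ‖a α‖ * Real.exp (∑ j, α j * v ε j + -(δ * ∑ j, |(α j : ℝ)|)) := by gcongr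
    _ = (‖a α‖ * Real.exp (∑ j, α j * v ε j)) * Real.exp (-(δ * ∑ j, |(α j : ℝ)|)) := by
        rw [Real.exp_add, mul_assoc]
    _ ≤ B * Real.exp (-(δ * ∑ j, |(α j : ℝ)|)) := by
        refine mul_le_mul_of_nonneg_right ?_ (Real.exp_pos _).le
        exact (hM ε α).trans ((le_abs_self _).trans
          (Finset.single_le_sum (f := fun ε => |M ε|) (fun _ _ => abs_nonneg _)
            (Finset.mem_univ ε)))

/-- At a point of `G` whose only zero coordinate is the `j`-th, the left side of `h` vanishes while
`z ^ α⁺` does not. -/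
theorem laurentCoeff_eq_zero {G : Set (Fin n → ℂ)} (hGo : IsOpen G) {A : (Fin n → ℂ) → ℂ}
    {α : Fin n → ℤ} {a : ℂ} (h : ∀ w ∈ G, A w * zmonomial α⁻ w = a * zmonomial α⁺ w)
    {j : Fin n} (hj : j ∈ vanishingCoords G) (hα : α j < 0) : a = 0 := by
  obtain ⟨z, hz, hzj⟩ := hj
  have ho : IsOpen ((fun y : Fin n → ℂ => Function.update y j 0) ⁻¹' G) :=
    hGo.preimage (by fun_prop)
  obtain ⟨y, hyG, hy⟩ := exists_mem_forall_ne_zero ho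
    ⟨z, by rw [mem_preimage, ← hzj, Function.update_eq_self]; exact hz⟩
  have h1 := h _ hyG
  have h2 : zmonomial α⁻ (Function.update y j 0) = 0 := by
    refine Finset.prod_eq_zero (Finset.mem_univ j) ?_
    rw [Function.update_self, zero_zpow]
    rw [Pi.negPart_apply, negPart_def]
    simp [hα.le, hα.ne]
  have h3 : zmonomial α⁺ (Function.update y j 0) ≠ 0 := by
    refine Finset.prod_ne_zero_iff.2 fun i _ => ?_
    rcases eq_or_ne i j with rfl | hij
    · rw [Pi.posPart_apply, posPart_eq_zero.2 hα.le]; simp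
    · rw [Function.update_of_ne hij]; exact zpow_ne_zero _ (hy i)
  rw [h2, mul_zero, eq_comm, mul_eq_zero] at h1
  exact h1.resolve_right h3

/-- Convexity takes care of the hull. Lowering a coordinate in `vanishingCoords G` cannot enlarge a
nonzero term, since its exponent there is nonnegative. -/
theorem logHull_subset_boundedTerms {G : Set (Fin n → ℂ)} {a : (Fin n → ℤ) → ℂ}
    (h : logImage G ⊆ boundedTerms a)
    (ha : ∀ α, ∀ j ∈ vanishingCoords G, α j < 0 → a α = 0) : logHull G ⊆ boundedTerms a := by
  rintro _ ⟨x, hx, s, hs, rfl⟩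
  obtain ⟨M, hM⟩ := convexHull_min h (convex_boundedTerms a) hx
  refine ⟨M, fun α => ?_⟩
  by_cases h0 : a α = 0
  · simpa [h0] using hM α
  refine (mul_le_mul_of_nonneg_left (Real.exp_le_exp.2 ?_) (norm_nonneg _)).trans (hM α)
  refine Finset.sum_le_sum fun j _ => ?_
  by_cases hj : j ∈ vanishingCoords G
  · have h1 : 0 ≤ α j := not_lt.1 fun hlt => h0 (ha α j hj hlt)
    have h2 : (0 : ℝ) ≤ α j := by exact_mod_cast h1
    have := mul_nonpos_of_nonneg_of_nonpos h2 (hs j).1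
    simp only [Pi.add_apply, mul_add]; linarith
  · simp [(hs j).2 hj]

/-- The open subset of `(ℂ∖0)ⁿ` with logarithmic image `C`. -/
def tube (C : Set (Fin n → ℝ)) : Set (Fin n → ℂ) :=
  {z | (∀ j, z j ≠ 0) ∧ (fun j => Real.log ‖z j‖) ∈ C}

theorem continuousAt_log_norm {z : Fin n → ℂ} (hz : ∀ j, z j ≠ 0) :
    ContinuousAt (fun (z : Fin n → ℂ) j => Real.log ‖z j‖) z :=
  continuousAt_pi.2 fun j => (continuous_apply j).continuousAt.norm.log (norm_ne_zero_iff.2 (hz j))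

theorem tube_mem_nhds {C : Set (Fin n → ℝ)} {z : Fin n → ℂ} (hz : ∀ j, z j ≠ 0)
    (hC : C ∈ 𝓝 fun j => Real.log ‖z j‖) : tube C ∈ 𝓝 z :=
  Filter.Eventually.and (p := fun z : Fin n → ℂ => ∀ j, z j ≠ 0)
    (eventually_all.2 fun j => (continuous_apply j).continuousAt.eventually_ne (hz j))
    ((continuousAt_log_norm hz) hC)

/-- The tube is the image of the connected set `C × ℝⁿ` under the exponential map. -/
theorem isRegion_tube {C : Set (Fin n → ℝ)} (hCo : IsOpen C) (hC : Convex ℝ C)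
    (hne : C.Nonempty) : IsRegion (tube C) := by
  refine ⟨isOpen_iff_mem_nhds.2 fun z hz => tube_mem_nhds hz.1 (hCo.mem_nhds hz.2), ?_⟩
  have himg : tube C = (fun (p : (Fin n → ℝ) × (Fin n → ℝ)) j =>
      Complex.exp (p.1 j + p.2 j * Complex.I)) '' (C ×ˢ univ) := by
    ext z
    constructor
    · rintro ⟨hz, hzC⟩
      refine ⟨(fun j => Real.log ‖z j‖, fun j => (z j).arg), ⟨hzC, trivial⟩, ?_⟩
      ext j
      simp only [Complex.exp_add, ← Complex.ofReal_exp, Real.exp_log (norm_pos_iff.2 (hz j)),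
        Complex.norm_mul_exp_arg_mul_I]
    · rintro ⟨⟨x, y⟩, ⟨hx, -⟩, rfl⟩
      refine ⟨fun j => Complex.exp_ne_zero _, ?_⟩
      simpa [Complex.norm_exp] using hx
  rw [himg]
  have hc : Continuous (fun (p : (Fin n → ℝ) × (Fin n → ℝ)) (j : Fin n) =>
      Complex.exp (p.1 j + p.2 j * Complex.I)) := by fun_prop
  exact IsConnected.image ⟨hne.prod univ_nonempty, (hC.prod convex_univ).isPreconnected⟩ _
    hc.continuousOn

/-- The logarithmic image of a circled domain of holomorphy is convex, and stable under decreasing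
the coordinates which vanish somewhere on the domain. -/
theorem logHull_subset_logImage {G : Set (Fin n → ℂ)} (hG : IsCircled G)
    (hhol : IsDomainOfHolomorphy G) : logHull G ⊆ logImage G := by
  obtain ⟨hGr, hmax⟩ := hhol
  obtain ⟨p, hpG, hp⟩ := exists_mem_forall_ne_zero hGr.1 hGr.2.nonempty
  have hpL := (hG.log_mem_logImage_iff hp).2 hpG
  have hTr : IsRegion (tube (logHull G)) := isRegion_tube (isOpen_logHull hGr.1)
    (convex_logHull G) ⟨_, logImage_subset_logHull G hpL⟩
  have hpT : p ∈ tube (logHull G) := ⟨hp, logImage_subset_logHull G hpL⟩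
  obtain ⟨r, hr, hrG⟩ := Metric.isOpen_iff.1 (hGr.1.inter hTr.1) p ⟨hpG, hpT⟩
  have hsub : tube (logHull G) ⊆ G := by
    by_contra hcon
    refine hmax ⟨ball p r, tube (logHull G), ⟨isOpen_ball, ⟨p, mem_ball_self hr⟩,
      (convex_ball p r).isPreconnected⟩, hTr, hrG, hcon, fun f hf => ?_⟩
    choose a ha using exists_laurentCoeff hGr hG hf
    have haG : ∀ w ∈ G, (∀ j, w j ≠ 0) → ∀ α, laurentPart f α w = a α * zmonomial α w := by
      intro w hw hw0 α
      have := ha α w hw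
      rw [← mul_zmonomial_negPart hw0, ← mul_assoc] at this
      exact mul_right_cancel₀ (zmonomial_ne_zero hw0) this
    -- Each term is a Fourier coefficient of `f` on a torus orbit, hence bounded by the maximum of
    -- `‖f‖` on that orbit.
    have hL : logImage G ⊆ boundedTerms a := by
      intro x hx
      obtain ⟨M, hM⟩ := exists_norm_rotate_le hG hf.continuousOn hx
      refine ⟨M, fun α => ?_⟩
      have h0 : ∀ j, (Real.exp (x j) : ℂ) ≠ 0 := fun j => by
        exact_mod_cast (Real.exp_pos (x j)).ne'
      have := norm_laurentPart_le hM α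
      rw [haG _ hx h0, norm_mul, norm_zmonomial h0] at this
      simpa [Complex.norm_exp] using this
    have hH := logHull_subset_boundedTerms hL fun α j hj hα =>
      laurentCoeff_eq_zero hGr.1 (ha α) hj hα
    have hloc : ∀ z ∈ tube (logHull G), ∃ u : (Fin n → ℤ) → ℝ, Summable u ∧ ∃ δ > 0,
        ∀ w ∈ ball z δ, (∀ j, w j ≠ 0) ∧ ∀ α, ‖a α * zmonomial α w‖ ≤ u α := by
      intro z hz
      obtain ⟨u, hu, δ, hδ, hb⟩ := exists_summable_bound (isOpen_logHull hGr.1) hH hz.2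
      obtain ⟨ε, hε, hεb⟩ := Metric.mem_nhds_iff.1
        (tube_mem_nhds hz.1 (isOpen_ball.mem_nhds (mem_ball_self hδ)))
      refine ⟨u, hu, ε, hε, fun w hw => ⟨(hεb hw).1, fun α => ?_⟩⟩
      rw [norm_mul, norm_zmonomial (hεb hw).1]
      exact hb _ (hεb hw).2 α
    refine ⟨fun z => ∑' α, a α * zmonomial α z, fun z hz => ?_, fun w hw => ?_⟩
    · obtain ⟨u, hu, δ, hδ, hb⟩ := hloc z hz
      exact (differentiableAt_tsum_of_norm_le hδ hu
        (fun α w hw => ((differentiableAt_zmonomial fun j =>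
          Or.inl ((hb w hw).1 j)).const_mul _).differentiableWithinAt)
        fun α w hw => (hb w hw).2 α).differentiableWithinAt
    · obtain ⟨hwG, hwT⟩ := hrG hw
      obtain ⟨u, hu, δ, hδ, hb⟩ := hloc w hwT
      have hs : Summable fun α => laurentPart f α w := by
        simp only [haG w hwG hwT.1]
        exact Summable.of_norm_bounded hu fun α => (hb w (mem_ball_self hδ)).2 α
      have := hasSum_laurentPart hG hf.continuousOn hwG hs
      simp only [haG w hwG hwT.1] at this
      exact this.tsum_eq
  intro x hx
  refine hsub ⟨fun j => ?_, ?_⟩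
  · exact Complex.ofReal_ne_zero.2 (Real.exp_pos (x j)).ne'
  · simpa [Complex.norm_exp] using hx

end LogImage

/-! ### Algebra of functions smooth up to the boundary -/

section BoundarySmooth

variable {n : ℕ}

/-- Holomorphic functions on `G` which extend continuously to the closure. -/
def holomorphicContinuous (G : Set (Fin n → ℂ)) : Set ((Fin n → ℂ) → ℂ) :=
  {f | DifferentiableOn ℂ f G ∧ ∃ g, ContinuousOn g (closure G) ∧ EqOn g f G}

/-- The functions all of whose iterated partial derivatives of order at most `k`, taken in any
order, are holomorphic on `G` and extend continuously to the closure. -/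
def boundarySmooth (G : Set (Fin n → ℂ)) : ℕ → Set ((Fin n → ℂ) → ℂ)
  | 0 => holomorphicContinuous G
  | k + 1 => {f | f ∈ holomorphicContinuous G ∧ ∀ j, partialDeriv j f ∈ boundarySmooth G k}

variable {G : Set (Fin n → ℂ)}

theorem partialDeriv_eq_fderiv {f : (Fin n → ℂ) → ℂ} {z : Fin n → ℂ}
    (hf : DifferentiableAt ℂ f z) (j : Fin n) :
    partialDeriv j f z = fderiv ℂ f z (Pi.single j 1) :=
  hf.lineDeriv_eq_fderiv

theorem eqOn_partialDeriv (hG : IsOpen G) {f g : (Fin n → ℂ) → ℂ} (h : EqOn f g G) (j : Fin n) :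
    EqOn (partialDeriv j f) (partialDeriv j g) G := fun _ hz =>
  (h.eventuallyEq_of_mem (hG.mem_nhds hz)).lineDeriv_eq

theorem holomorphicContinuous_congr {f g : (Fin n → ℂ) → ℂ} (hf : f ∈ holomorphicContinuous G)
    (h : EqOn f g G) : g ∈ holomorphicContinuous G := by
  obtain ⟨hd, e, he, hef⟩ := hf
  exact ⟨hd.congr h.symm, e, he, hef.trans h⟩

theorem boundarySmooth_subset (k : ℕ) : boundarySmooth G k ⊆ holomorphicContinuous G := by
  cases k with
  | zero => exact subset_rfl
  | succ k => exact fun f hf => hf.1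

theorem boundarySmooth_congr (hG : IsOpen G) {k : ℕ} {f g : (Fin n → ℂ) → ℂ}
    (hf : f ∈ boundarySmooth G k) (h : EqOn f g G) : g ∈ boundarySmooth G k := by
  induction k generalizing f g with
  | zero => exact holomorphicContinuous_congr hf h
  | succ k ih =>
    exact ⟨holomorphicContinuous_congr hf.1 h, fun j => ih (hf.2 j) (eqOn_partialDeriv hG h j)⟩

theorem boundarySmooth_of_succ {k : ℕ} {f : (Fin n → ℂ) → ℂ} (hf : f ∈ boundarySmooth G (k + 1)) :
    f ∈ boundarySmooth G k := by
  induction k generalizing f with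
  | zero => exact hf.1
  | succ k ih => exact ⟨hf.1, fun j => ih (hf.2 j)⟩

theorem const_mem_boundarySmooth (c : ℂ) (k : ℕ) :
    (fun _ => c) ∈ boundarySmooth G k := by
  have h0 (c : ℂ) : (fun _ => c) ∈ holomorphicContinuous G :=
    ⟨differentiableOn_const c, fun _ => c, continuousOn_const, fun _ _ => rfl⟩
  induction k generalizing c with
  | zero => exact h0 c
  | succ k ih =>
    refine ⟨h0 c, fun j => ?_⟩
    convert ih 0 using 1
    ext z
    simp [partialDeriv, lineDeriv]

theorem add_mem_boundarySmooth (hG : IsOpen G) {k : ℕ} {f g : (Fin n → ℂ) → ℂ}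
    (hf : f ∈ boundarySmooth G k) (hg : g ∈ boundarySmooth G k) :
    (fun z => f z + g z) ∈ boundarySmooth G k := by
  have h0 {f g : (Fin n → ℂ) → ℂ} (hf : f ∈ holomorphicContinuous G)
      (hg : g ∈ holomorphicContinuous G) : (fun z => f z + g z) ∈ holomorphicContinuous G := by
    obtain ⟨hd, e, he, hef⟩ := hf
    obtain ⟨hd', e', he', hef'⟩ := hg
    exact ⟨hd.add hd', _, he.add he', fun z hz => by simp [hef hz, hef' hz]⟩
  induction k generalizing f g with
  | zero => exact h0 hf hg
  | succ k ih =>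
    refine ⟨h0 hf.1 hg.1, fun j => boundarySmooth_congr hG (ih (hf.2 j) (hg.2 j)) fun z hz => ?_⟩
    have h1 := hf.1.1.differentiableAt (hG.mem_nhds hz)
    have h2 := hg.1.1.differentiableAt (hG.mem_nhds hz)
    rw [partialDeriv_eq_fderiv h1, partialDeriv_eq_fderiv h2,
      partialDeriv_eq_fderiv (h1.fun_add h2), fderiv_fun_add h1 h2]
    rfl

theorem mul_mem_boundarySmooth (hG : IsOpen G) {k : ℕ} {f g : (Fin n → ℂ) → ℂ}
    (hf : f ∈ boundarySmooth G k) (hg : g ∈ boundarySmooth G k) :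
    (fun z => f z * g z) ∈ boundarySmooth G k := by
  have h0 {f g : (Fin n → ℂ) → ℂ} (hf : f ∈ holomorphicContinuous G)
      (hg : g ∈ holomorphicContinuous G) : (fun z => f z * g z) ∈ holomorphicContinuous G := by
    obtain ⟨hd, e, he, hef⟩ := hf
    obtain ⟨hd', e', he', hef'⟩ := hg
    exact ⟨hd.mul hd', _, he.mul he', fun z hz => by simp [hef hz, hef' hz]⟩
  induction k generalizing f g with
  | zero => exact h0 hf hg
  | succ k ih =>
    refine ⟨h0 hf.1 hg.1, fun j => boundarySmooth_congr hG (add_mem_boundarySmooth hG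
      (ih (boundarySmooth_of_succ hf) (hg.2 j)) (ih (boundarySmooth_of_succ hg) (hf.2 j)))
      fun z hz => ?_⟩
    have h1 := hf.1.1.differentiableAt (hG.mem_nhds hz)
    have h2 := hg.1.1.differentiableAt (hG.mem_nhds hz)
    rw [partialDeriv_eq_fderiv h1, partialDeriv_eq_fderiv h2,
      partialDeriv_eq_fderiv (h1.fun_mul h2), fderiv_fun_mul h1 h2]
    simp

theorem inv_mem_boundarySmooth (hG : IsOpen G) {k : ℕ} {f : (Fin n → ℂ) → ℂ}
    (hf : f ∈ boundarySmooth G k) {c : ℝ} (hc : 0 < c) (hfc : ∀ z ∈ G, c ≤ ‖f z‖) :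
    (fun z => (f z)⁻¹) ∈ boundarySmooth G k := by
  have hne : ∀ z ∈ G, f z ≠ 0 := fun z hz => norm_pos_iff.1 (hc.trans_le (hfc z hz))
  have h0 : (fun z => (f z)⁻¹) ∈ holomorphicContinuous G := by
    obtain ⟨hd, e, he, hef⟩ := boundarySmooth_subset k hf
    -- The lower bound passes to the closure, so the continuous extension can be inverted there.
    have hec : ∀ z ∈ closure G, c ≤ ‖e z‖ := fun z hz =>
      le_on_closure (f := fun _ => c) (fun z hz => by rw [hef hz]; exact hfc z hz)
        continuousOn_const he.norm hz
    exact ⟨hd.inv hne, _, he.inv₀ fun z hz => norm_pos_iff.1 (hc.trans_le (hec z hz)),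
      fun z hz => by simp [hef hz]⟩
  induction k with
  | zero => exact h0
  | succ k ih =>
    have hi := ih (boundarySmooth_of_succ hf)
    refine ⟨h0, fun j => boundarySmooth_congr hG (mul_mem_boundarySmooth hG
      (const_mem_boundarySmooth (-1) k) (mul_mem_boundarySmooth hG (hf.2 j)
        (mul_mem_boundarySmooth hG hi hi))) fun z hz => ?_⟩
    have h1 := hf.1.1.differentiableAt (hG.mem_nhds hz)
    have h2 : HasFDerivAt (fun z => (f z)⁻¹) _ z :=
      (hasDerivAt_inv (hne z hz)).comp_hasFDerivAt z h1.hasFDerivAt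
    rw [partialDeriv_eq_fderiv h1, partialDeriv_eq_fderiv h2.differentiableAt, h2.fderiv]
    simp
    field_simp

theorem iterate_partialDeriv_mem_boundarySmooth (j : Fin n) {m k : ℕ} {f : (Fin n → ℂ) → ℂ}
    (hf : f ∈ boundarySmooth G (m + k)) : (partialDeriv j)^[m] f ∈ boundarySmooth G k := by
  induction m generalizing f with
  | zero => simpa using hf
  | succ m ih =>
    rw [Function.iterate_succ_apply]
    rw [Nat.add_right_comm] at hf
    exact ih (hf.2 j)

/-- The recursive class lends itself to the product and quotient rules; the derivatives `∂^ν` are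
iterated partial derivatives in one particular order. -/
theorem boundarySmooth_subset_spaceA (k : ℕ) : boundarySmooth G k ⊆ spaceA k G := by
  intro f hf
  refine ⟨(boundarySmooth_subset k hf).1, fun ν hν => ?_⟩
  have key : ∀ (l : List (Fin n)) (r : ℕ), f ∈ boundarySmooth G ((l.map ν).sum + r) →
      l.foldr (fun j g => (partialDeriv j)^[ν j] g) f ∈ boundarySmooth G r := by
    intro l
    induction l with
    | nil => intro r h; simpa using h
    | cons j l ih =>
      intro r h
      refine iterate_partialDeriv_mem_boundarySmooth j (ih (ν j + r) ?_)
      rw [List.map_cons, List.sum_cons] at h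
      rwa [← add_assoc, add_comm (l.map ν).sum]
  have hs : ((List.finRange n).map ν).sum = ∑ j, ν j := by
    rw [← List.ofFn_eq_map, List.sum_ofFn]
  have := key (List.finRange n) (k - ∑ j, ν j) (by rw [hs, Nat.add_sub_cancel' hν]; exact hf)
  exact (boundarySmooth_subset _ this).2

theorem partialDeriv_zmonomial {α : Fin n → ℤ} {z : Fin n → ℂ} {j : Fin n}
    (h : z j ≠ 0 ∨ 0 ≤ α j) :
    partialDeriv j (zmonomial α) z = α j * zmonomial (α - Pi.single j 1) z := by
  have hsplit (β : Fin n → ℤ) (w : Fin n → ℂ) :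
      zmonomial β w = w j ^ β j * ∏ i ∈ Finset.univ.erase j, w i ^ β i :=
    (Finset.mul_prod_erase _ _ (Finset.mem_univ j)).symm
  have h1 : (fun t : ℂ => zmonomial α (z + t • Pi.single j 1)) =
      fun t => (z j + t) ^ α j * ∏ i ∈ Finset.univ.erase j, z i ^ α i := by
    ext t
    rw [hsplit]
    congr 1
    · simp
    · refine Finset.prod_congr rfl fun i hi => ?_
      simp [Finset.ne_of_mem_erase hi]
  have h2 : HasDerivAt (fun t : ℂ => (z j + t) ^ α j) (α j * z j ^ (α j - 1)) 0 := by
    have h3 : HasDerivAt (fun t : ℂ => z j + t) 1 0 := (hasDerivAt_id (0 : ℂ)).const_add _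
    have h4 := hasDerivAt_zpow (α j) (z j) h
    have := HasDerivAt.comp_of_eq (h₂ := fun x : ℂ => x ^ α j) (0 : ℂ) h4 h3 (by simp)
    simpa [Function.comp_def] using this
  rw [partialDeriv, lineDeriv, h1, (h2.mul_const _).deriv, hsplit, mul_assoc]
  congr 2
  · simp
  · refine Finset.prod_congr rfl fun i hi => ?_
    simp [Finset.ne_of_mem_erase hi]

/-- The exponents `α` for which `z ^ α` decays to order `k + 1` along the coordinate hyperplanes
in `G`. -/
def decayingExponents (G : Set (Fin n → ℂ)) (k : ℕ) : Set (Fin n → ℤ) :=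
  {α | (∀ j ∈ vanishingCoords G, (k : ℤ) + 1 ≤ α j) ∧
    ∃ c, 0 ≤ c ∧ ∀ z ∈ G, (∀ j, z j ≠ 0) → ‖zmonomial α z‖ ≤ c * ∏ j, ‖z j‖ ^ (k + 1)}

theorem zmonomial_mem_holomorphicContinuous {k : ℕ} {α : Fin n → ℤ}
    (hα : α ∈ decayingExponents G k) : zmonomial α ∈ holomorphicContinuous G := by
  classical
  obtain ⟨hv, c, hc, hb⟩ := hα
  have hnv : ∀ z ∈ G, ∀ j, z j = 0 → 0 < α j := fun z hz j hj => by
    have := hv j ⟨z, hz, hj⟩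
    lia
  refine ⟨fun z hz => (differentiableAt_zmonomial fun j => ?_).differentiableWithinAt, ?_⟩
  · by_cases hj : z j = 0
    · exact Or.inr (hnv z hz j hj).le
    · exact Or.inl hj
  -- The extension is zero on the coordinate hyperplanes. The decay bound persists on the closure
  -- and squeezes `g` to zero there.
  let g : (Fin n → ℂ) → ℂ := fun z => if ∀ j, z j ≠ 0 then zmonomial α z else 0
  let m : (Fin n → ℂ) → ℝ := fun z => c * ∏ j, ‖z j‖ ^ (k + 1)
  have hm : Continuous m := by fun_prop
  have hm0 : ∀ z, 0 ≤ m z := fun z => by positivity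
  have hopen : ∀ z : Fin n → ℂ, (∀ j, z j ≠ 0) → ∀ᶠ w in 𝓝 z, ∀ j, w j ≠ 0 := fun z hz =>
    eventually_all.2 fun j => (continuous_apply j).continuousAt.eventually_ne (hz j)
  have hca : ∀ z : Fin n → ℂ, (∀ j, z j ≠ 0) → ContinuousAt (zmonomial α) z := fun z hz =>
    (differentiableAt_zmonomial fun j => Or.inl (hz j)).continuousAt
  have hgm : ∀ z ∈ closure G, ‖g z‖ ≤ m z := by
    intro z hz
    by_cases h : ∀ j, z j ≠ 0
    · simp only [g, if_pos h]
      by_contra! hlt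
      have h1 : ∀ᶠ w in 𝓝 z, m w < ‖zmonomial α w‖ :=
        hm.continuousAt.eventually_lt (hca z h).norm hlt
      obtain ⟨w, hwG, hw, hw0⟩ :=
        ((mem_closure_iff_frequently.1 hz).and_eventually (h1.and (hopen z h))).exists
      exact absurd (hb w hwG hw0) (not_le.2 hw)
    · simp only [g, if_neg h, norm_zero, hm0]
  refine ⟨g, fun z hz => ?_, fun z hz => ?_⟩
  · by_cases h : ∀ j, z j ≠ 0
    · refine ((hca z h).congr ?_).continuousWithinAt
      filter_upwards [hopen z h] with w hw
      simp only [g, if_pos hw]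
    · have hmz : m z = 0 := by
        push Not at h
        obtain ⟨j, hj⟩ := h
        have : ∏ j, ‖z j‖ ^ (k + 1) = 0 :=
          Finset.prod_eq_zero (Finset.mem_univ j) (by simp [hj])
        simp [m, this]
      have hgz : g z = 0 := by simp only [g, if_neg h]
      rw [ContinuousWithinAt, hgz]
      refine squeeze_zero_norm' (eventually_mem_nhdsWithin.mono fun w hw => hgm w hw) ?_
      rw [← hmz]
      exact hm.continuousWithinAt
  · by_cases h : ∀ j, z j ≠ 0
    · simp only [g, if_pos h]
    · simp only [g, if_neg h]
      push Not at h
      obtain ⟨j, hj⟩ := h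
      exact (Finset.prod_eq_zero (Finset.mem_univ j)
        (by rw [hj, zero_zpow _ (hnv z hz j hj).ne'])).symm

/-- Dividing by `z j` costs one of the decay factors; the spare factors in the other coordinates are
bounded because `G` is. -/
theorem sub_single_mem_decayingExponents (hbdd : Bornology.IsBounded G) {k : ℕ} {α : Fin n → ℤ}
    (hα : α ∈ decayingExponents G (k + 1)) (j : Fin n) :
    α - Pi.single j 1 ∈ decayingExponents G k := by
  obtain ⟨hv, c, hc, hb⟩ := hα
  obtain ⟨R, hR⟩ := hbdd.exists_norm_le
  refine ⟨fun i hi => ?_, c * ∏ i ∈ Finset.univ.erase j, |R|, by positivity, fun z hz h0 => ?_⟩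
  · have h1 := hv i hi
    have h2 : (Pi.single j 1 : Fin n → ℤ) i ≤ 1 := by
      rw [Pi.single_apply]; split_ifs <;> simp
    push_cast at h1
    simp only [Pi.sub_apply]
    lia
  have h1 : zmonomial (α - Pi.single j 1) z * z j = zmonomial α z := by
    have h2 : zmonomial (Pi.single j 1) z = z j := by
      rw [zmonomial, Finset.prod_eq_single j] <;> simp +contextual
    rw [← h2, ← zmonomial_add h0, sub_add_cancel]
  have hzj : 0 < ‖z j‖ := norm_pos_iff.2 (h0 j)
  refine le_of_mul_le_mul_right ?_ hzj
  rw [← norm_mul, h1]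
  calc ‖zmonomial α z‖ ≤ c * ∏ i, ‖z i‖ ^ (k + 1 + 1) := hb z hz h0
    _ = c * (∏ i ∈ Finset.univ.erase j, ‖z i‖) * (∏ i, ‖z i‖ ^ (k + 1)) * ‖z j‖ := by
        simp only [pow_succ _ (k + 1), Finset.prod_mul_distrib]
        rw [← Finset.mul_prod_erase Finset.univ (fun i => ‖z i‖) (Finset.mem_univ j)]
        ring
    _ ≤ _ := by
        gcongr with i
        exact ((norm_le_pi_norm z i).trans (hR z hz)).trans (le_abs_self R)

theorem zmonomial_mem_boundarySmooth (hG : IsOpen G) (hbdd : Bornology.IsBounded G) {k : ℕ}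
    {α : Fin n → ℤ} (hα : α ∈ decayingExponents G k) : zmonomial α ∈ boundarySmooth G k := by
  induction k generalizing α with
  | zero => exact zmonomial_mem_holomorphicContinuous hα
  | succ k ih =>
    refine ⟨zmonomial_mem_holomorphicContinuous hα, fun j => boundarySmooth_congr hG
      (mul_mem_boundarySmooth hG (const_mem_boundarySmooth (α j : ℂ) k)
        (ih (sub_single_mem_decayingExponents hbdd hα j))) fun z hz => ?_⟩
    refine (partialDeriv_zmonomial ?_).symm
    by_cases hj : z j = 0
    · have := hα.1 j ⟨z, hz, hj⟩
      right
      lia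
    · exact Or.inl hj

end BoundarySmooth

/-! ### Separation by monomials -/

section Separation

open scoped Pointwise

variable {n : ℕ} {G : Set (Fin n → ℂ)}

/-- Exponentiating with the arguments of `z` held fixed is continuous, and carries the logarithmic
image into `G` and `log ‖z‖` to `z`. -/
theorem IsCircled.log_norm_notMem_closure (hG : IsCircled G) {z : Fin n → ℂ}
    (hz : ∀ j, z j ≠ 0) (hzG : z ∉ closure G) :
    (fun j => Real.log ‖z j‖) ∉ closure (logImage G) := by
  intro h
  let φ : (Fin n → ℝ) → (Fin n → ℂ) := fun y j => Real.exp (y j) * (z j / ‖z j‖)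
  have hφ : Continuous φ := by fun_prop
  have hn (j : Fin n) : (‖z j‖ : ℂ) ≠ 0 := by simpa using hz j
  have h1 : φ (fun j => Real.log ‖z j‖) = z := by
    ext j
    simp only [φ, Real.exp_log (norm_pos_iff.2 (hz j))]
    rw [mul_div_cancel₀ _ (hn j)]
  refine hzG (h1 ▸ map_mem_closure hφ h fun y hy => ?_)
  have h0 : ∀ j, φ y j ≠ 0 := fun j =>
    mul_ne_zero (Complex.ofReal_ne_zero.2 (Real.exp_pos _).ne') (div_ne_zero (hz j) (hn j))
  refine (hG.log_mem_logImage_iff h0).1 ?_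
  convert hy using 2 with j
  have : ‖φ y j‖ = Real.exp (y j) := by
    simp [φ, Complex.norm_exp, hz j]
  rw [this, Real.log_exp]

/-- A point outside the closure of a bounded circled domain of holomorphy is separated from it by
a monomial which decays to any prescribed order along the coordinate hyperplanes. -/
theorem exists_decayingExponent_separating (hbdd : Bornology.IsBounded G) (hG : IsCircled G)
    (hhol : IsDomainOfHolomorphy G) (k : ℕ) {z₀ : Fin n → ℂ} (hz₀ : ∀ j, z₀ j ≠ 0)
    (hz₀G : z₀ ∉ closure G) :
    ∃ α ∈ decayingExponents G k, ∃ c < ‖zmonomial α z₀‖, ∀ z ∈ G, ‖zmonomial α z‖ ≤ c := by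
  have hLL := logHull_subset_logImage hG hhol
  have hLeq : logImage G = logHull G := (logImage_subset_logHull G).antisymm hLL
  have hLc : Convex ℝ (logImage G) := hLeq ▸ convex_logHull G
  set x₀ : Fin n → ℝ := fun j => Real.log ‖z₀ j‖
  obtain ⟨f, u, hfu, hux⟩ := geometric_hahn_banach_closed_point hLc.closure isClosed_closure
    (hG.log_norm_notMem_closure hz₀ hz₀G)
  replace hfu : ∀ x ∈ logImage G, f x < u := fun x hx => hfu x (subset_closure hx)
  let β : Fin n → ℝ := fun j => f (Pi.single j 1)
  have hf (x : Fin n → ℝ) : f x = ∑ j, β j * x j := by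
    have hx : x = ∑ j, x j • (Pi.single j 1 : Fin n → ℝ) := by
      ext i; simp [Pi.single_apply]
    conv_lhs => rw [hx]
    simp [β, mul_comm]
  obtain ⟨p, hpG, hp⟩ := exists_mem_forall_ne_zero hhol.1.1 hhol.1.2.nonempty
  -- If `β j` were negative, lowering the `j`-th coordinate would stay in the logarithmic image and
  -- raise `f` to the forbidden value `u`.
  have hβ : ∀ j ∈ vanishingCoords G, 0 ≤ β j := by
    intro j hj
    by_contra! hlt
    set x := fun j => Real.log ‖p j‖
    have hx : x ∈ logImage G := (hG.log_mem_logImage_iff hp).2 hpG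
    have ht : 0 ≤ (u - f x) / (-β j) := div_nonneg (sub_nonneg.2 (hfu x hx).le) (by linarith)
    have h1 : x + Pi.single j (-((u - f x) / (-β j))) ∈ logHull G := by
      refine add_mem_add (subset_convexHull _ _ hx) fun i => ?_
      rcases eq_or_ne i j with rfl | hij
      · simp only [Pi.single_eq_same]
        exact ⟨neg_nonpos.2 ht, fun h => absurd hj h⟩
      · simp [hij]
    have h2 := hfu _ (hLL h1)
    have h3 (t : ℝ) : f (Pi.single j t) = β j * t := by
      rw [hf]; simp [Pi.single_apply]
    rw [map_add, h3] at h2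
    have : β j * -((u - f x) / (-β j)) = u - f x := by field_simp [hlt.ne]
    linarith
  obtain ⟨R, hR0, hR⟩ : ∃ R, 0 ≤ R ∧ ∀ z ∈ G, ∀ j, Real.log ‖z j‖ ≤ R := by
    obtain ⟨R, hR⟩ := hbdd.exists_norm_le
    exact ⟨|R|, abs_nonneg R, fun z hz j => (Real.log_le_self (norm_nonneg _)).trans
      ((norm_le_pi_norm z j).trans ((hR z hz).trans (le_abs_self R)))⟩
  let S := ∑ j, |x₀ j|
  -- The gain `N * (f x₀ - u)` must exceed the total effect of rounding and shifting: at most `(k +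
  -- 2) * n * R` on `G` and `(k + 2) * S` at `z₀`.
  obtain ⟨N, hN⟩ := exists_nat_gt ((k + 2) * (n * R + S) / (f x₀ - u))
  rw [div_lt_iff₀ (sub_pos.2 hux)] at hN
  -- Rounding up and adding `k + 1` puts the excess `η j` between `k + 1`, needed for decay, and `k
  -- + 2`.
  let α : Fin n → ℤ := fun j => ⌈N * β j⌉ + (k + 1)
  let η : Fin n → ℝ := fun j => α j - N * β j
  have hη1 (j : Fin n) : (k : ℝ) + 1 ≤ η j := by
    have := Int.le_ceil (N * β j)
    simp only [η, α]; push_cast; linarith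
  have hη2 (j : Fin n) : η j ≤ k + 2 := by
    have := Int.ceil_lt_add_one (N * β j)
    simp only [η, α]; push_cast; linarith
  have hη0 (j : Fin n) : 0 ≤ η j := le_trans (by positivity) (hη1 j)
  have hα (x : Fin n → ℝ) : ∑ j, α j * x j = N * f x + ∑ j, η j * x j := by
    rw [hf, Finset.mul_sum, ← Finset.sum_add_distrib]
    exact Finset.sum_congr rfl fun j _ => by simp only [η]; ring
  have hαv : ∀ j ∈ vanishingCoords G, (k : ℤ) + 1 ≤ α j := by
    intro j hj
    have : (0 : ℤ) ≤ ⌈N * β j⌉ := Int.ceil_nonneg (mul_nonneg (Nat.cast_nonneg N) (hβ j hj))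
    simp only [α]; lia
  have hfG : ∀ z ∈ G, (∀ j, z j ≠ 0) → N * f (fun j => Real.log ‖z j‖) ≤ N * u :=
    fun z hz h0 => mul_le_mul_of_nonneg_left (hfu _ ((hG.log_mem_logImage_iff h0).2 hz)).le
      (Nat.cast_nonneg N)
  refine ⟨α, ⟨hαv, Real.exp (N * u + ∑ j, (η j - (k + 1)) * R), (Real.exp_pos _).le,
    fun z hz h0 => ?_⟩, Real.exp (N * u + (k + 2) * (n * R)), ?_, fun z hz => ?_⟩
  · have hprod : ∏ j, ‖z j‖ ^ (k + 1) = Real.exp (∑ j, (k + 1) * Real.log ‖z j‖) := by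
      rw [Real.exp_sum]
      refine Finset.prod_congr rfl fun j _ => ?_
      have := Real.exp_nat_mul (Real.log ‖z j‖) (k + 1)
      rw [Real.exp_log (norm_pos_iff.2 (h0 j))] at this
      rw [← this]; push_cast; rfl
    rw [hprod, ← Real.exp_add, norm_zmonomial h0, Real.exp_le_exp, hα, add_assoc,
      ← Finset.sum_add_distrib]
    refine add_le_add (hfG z hz h0) (Finset.sum_le_sum fun j _ => ?_)
    have := mul_le_mul_of_nonneg_left (hR z hz j) (sub_nonneg.2 (hη1 j))
    linarith
  · rw [norm_zmonomial hz₀, Real.exp_lt_exp, hα]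
    have : -((k + 2) * S) ≤ ∑ j, η j * x₀ j := by
      rw [Finset.mul_sum, ← Finset.sum_neg_distrib]
      refine Finset.sum_le_sum fun j _ => ?_
      calc -((k + 2) * |x₀ j|) ≤ -(η j * |x₀ j|) :=
            neg_le_neg (mul_le_mul_of_nonneg_right (hη2 j) (abs_nonneg _))
        _ = η j * -|x₀ j| := by ring
        _ ≤ η j * x₀ j := mul_le_mul_of_nonneg_left (neg_abs_le _) (hη0 j)
    change _ < N * f x₀ + ∑ j, η j * x₀ j
    linarith
  · by_cases h0 : ∀ j, z j ≠ 0
    · rw [norm_zmonomial h0, Real.exp_le_exp, hα]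
      refine add_le_add (hfG z hz h0) ?_
      calc ∑ j, η j * Real.log ‖z j‖ ≤ ∑ _j : Fin n, (k + 2) * R :=
            Finset.sum_le_sum fun j _ =>
              (mul_le_mul_of_nonneg_left (hR z hz j) (hη0 j)).trans
                (mul_le_mul_of_nonneg_right (hη2 j) hR0)
        _ = (k + 2) * (n * R) := by
            rw [Finset.sum_const, Finset.card_univ, Fintype.card_fin, nsmul_eq_mul]; ring
    · push Not at h0
      obtain ⟨j, hj⟩ := h0
      have := hαv j ⟨z, hz, hj⟩
      have h1 : zmonomial α z = 0 := Finset.prod_eq_zero (Finset.mem_univ j)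
        (by rw [hj, zero_zpow]; lia)
      rw [h1, norm_zero]
      exact (Real.exp_pos _).le

theorem mul_zmonomial_negPart_of_mem {k : ℕ} {α : Fin n → ℤ} (hα : α ∈ decayingExponents G k)
    {z : Fin n → ℂ} (hz : z ∈ G) : zmonomial α z * zmonomial α⁻ z = zmonomial α⁺ z := by
  by_cases h0 : ∀ j, z j ≠ 0
  · exact mul_zmonomial_negPart h0
  push Not at h0
  obtain ⟨j, hj⟩ := h0
  have hαj : 0 < α j := by
    have := hα.1 j ⟨z, hz, hj⟩
    lia
  have h1 : zmonomial α z = 0 := Finset.prod_eq_zero (Finset.mem_univ j)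
    (by rw [hj, zero_zpow _ hαj.ne'])
  have h2 : zmonomial α⁺ z = 0 := Finset.prod_eq_zero (Finset.mem_univ j)
    (by rw [Pi.posPart_apply, posPart_eq_self.2 hαj.le, hj, zero_zpow _ hαj.ne'])
  rw [h1, h2, zero_mul]

end Separation

/-! ### A function in `𝒜^k(G)` that does not extend -/

theorem isDomainOfHolomorphyFor_spaceA {n : ℕ} (G : Set (Fin n → ℂ))
    (hbdd : Bornology.IsBounded G)
    (hfat : IsFat G)
    (hcirc : IsCircled G)
    (hhol : IsDomainOfHolomorphy G)
    (k : ℕ) :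
    IsDomainOfHolomorphyFor (spaceA k G) G := by
  refine ⟨hhol.1, ?_⟩
  rintro ⟨G₀, G', hG₀, hG', hsub, hnot, hext⟩
  have hne : (G' \ closure G).Nonempty := by
    rw [sdiff_nonempty]
    intro h
    apply hnot
    rw [hfat]
    exact interior_maximal h hG'.1
  obtain ⟨z₀, ⟨hz₀G', hz₀⟩, hz₀n⟩ :=
    exists_mem_forall_ne_zero (hG'.1.sdiff isClosed_closure) hne
  obtain ⟨α, hα, c, hc, hcG⟩ := exists_decayingExponent_separating hbdd hcirc hhol k hz₀n hz₀
  set w := zmonomial α z₀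
  have hlow : ∀ z ∈ G, ‖w‖ - c ≤ ‖zmonomial α z + -w‖ := fun z hz => by
    have h1 := norm_sub_norm_le w (zmonomial α z)
    rw [norm_sub_rev, sub_eq_add_neg (zmonomial α z)] at h1
    linarith [hcG z hz]
  have hmem := boundarySmooth_subset_spaceA k (inv_mem_boundarySmooth hhol.1.1
    (add_mem_boundarySmooth hhol.1.1 (zmonomial_mem_boundarySmooth hhol.1.1 hbdd hα)
      (const_mem_boundarySmooth (-w) k)) (sub_pos.2 hc) hlow)
  obtain ⟨g, hg, hgG⟩ := hext _ hmem
  have h1 (z : Fin n → ℂ) : DifferentiableAt ℂ (zmonomial α⁻) z :=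
    differentiableAt_zmonomial fun j => Or.inr (negPart_nonneg α j)
  have h2 (z : Fin n → ℂ) : DifferentiableAt ℂ (zmonomial α⁺) z :=
    differentiableAt_zmonomial fun j => Or.inr (posPart_nonneg α j)
  -- The relation `g * (z ^ α - w) = 1` is multiplied by `z ^ α⁻`, because `G'` may meet hyperplanes
  -- on which `z ^ α` has poles. At `z₀` the bracket vanishes, leaving `z₀ ^ α⁻ = 0`, which is
  -- absurd.
  have hzero := eqOn_zero_of_isPreconnected
    (f := fun z => g z * (zmonomial α⁺ z - w * zmonomial α⁻ z) - zmonomial α⁻ z) hG'.1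
    hG'.2.isPreconnected
    (DifferentiableOn.sub (DifferentiableOn.mul hg fun z _ =>
      ((h2 z).sub ((h1 z).const_mul w)).differentiableWithinAt)
      fun z _ => (h1 z).differentiableWithinAt)
    hG₀.1 hG₀.2.nonempty (fun z hz => (hsub hz).2) (fun z hz => by
      have hzG := (hsub hz).1
      have hne : zmonomial α z + -w ≠ 0 :=
        norm_pos_iff.1 ((sub_pos.2 hc).trans_le (hlow z hzG))
      simp only [hgG hz, ← mul_zmonomial_negPart_of_mem hα hzG]
      rw [← sub_mul, sub_eq_add_neg (zmonomial α z), inv_mul_cancel_left₀ hne, sub_self])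
    z₀ hz₀G'
  simp only [← mul_zmonomial_negPart hz₀n] at hzero
  simp only [w, sub_self, mul_zero, zero_sub, neg_eq_zero] at hzero
  exact zmonomial_ne_zero hz₀n hzero

end CircledDomains

theorem corollary4 {n : ℕ} (G : Set (Fin n → ℂ))
    (hbdd : Bornology.IsBounded G)
    (hfat : CircledDomains.IsFat G)
    (hcirc : CircledDomains.IsCircled G)
    (hhol : CircledDomains.IsDomainOfHolomorphy G)
    (k : ℕ) :
    CircledDomains.IsDomainOfHolomorphyFor (CircledDomains.spaceA k G) G :=
  CircledDomains.isDomainOfHolomorphyFor_spaceA G hbdd hfat hcirc hhol k
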